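/- **Theorem (Temple's inequality).** Let $H$ be a (possibly unbounded, densely defined) selfadjoint operator with domain $\mathcal D(H)$ on a complex Hilbert space $\mathcal H$ which is bounded from below, i.e. $\langle\psi,H\psi\rangle\ge c\,\|\psi\|^2$ for some $c\in\mathbb R$ and all $\psi\in\mathcal D(H)$. Suppose that $H$ has a ground state, i.e. $E_0:=\inf\sigma(H)$ is an eigenvalue of $H$. Let the essential spectrum $\sigma_{\mathrm{ess}}(H)$ be the set of points of $\sigma(H)$ that are not isolated eigenvalues of finite multiplicity, and let $$E_1:=\min\bigl\{\inf\{E>E_0 : E \text{ is an eigenvalue of } H\},\ \inf\sigma_{\mathrm{ess}}(H)\bigr\}\in[E_0,+\infty]$$ (with $\inf\emptyset=+\infty$), i.e. $E_1$ is the next eigenvalue or the bottom of the essential spectrum, whichever is lower. Assume $E_0<E_1$. Then for every real $\mu\in(E_0,E_1)$ and every $\psi\in\mathcal D(H)$ with $\|\psi\|=1$ and $\langle\psi,H\psi\rangle<\mu$, $$E_0\ \ge\ \langle\psi,H\psi\rangle-\frac{\mathrm{Var}_\psi(H)}{\mu-\langle\psi,H\psi\rangle},$$ where $\mathrm{Var}_\psi(H):=\bigl\|\bigl(H-\langle\psi,H\psi\rangle\bigr)\psi\bigr\|^2=\|H\psi\|^2-\langle\psi,H\psi\rangle^2$.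 If moreover $H\psi\in\mathcal D(H)$, then $\mathrm{Var}_\psi(H)=\langle\psi,H^2\psi\rangle-\langle\psi,H\psi\rangle^2$, so that $$E_0\ \ge\ \langle\psi,H\psi\rangle-\frac{\langle\psi,H^2\psi\rangle-\langle\psi,H\psi\rangle^2}{\mu-\langle\psi,H\psi\rangle}.$$ -/

import Mathlib

/-! Unbounded operators `H : D(H) ⊆ 𝓗 → 𝓗` on a complex Hilbert space are Mathlib's partially
defined linear maps `𝓗 →ₗ.[ℂ] 𝓗`, and selfadjointness is Mathlib's `IsSelfAdjoint H`, that is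
`H† = H` with equality of domains (this forces `D(H)` to be dense). -/

noncomputable section

namespace QM

variable {𝓗 : Type*} [NormedAddCommGroup 𝓗] [InnerProductSpace ℂ 𝓗]

/-- The operator `H - z`, defined on `D(H)`. -/
def shift (H : 𝓗 →ₗ.[ℂ] 𝓗) (z : ℂ) : H.domain →ₗ[ℂ] 𝓗 :=
  H.toFun - z • H.domain.subtype

/-- The resolvent set: `H - z : D(H) → 𝓗` has a bounded, everywhere defined, two-sided inverse. -/
def resolventSet (H : 𝓗 →ₗ.[ℂ] 𝓗) : Set ℂ :=
  {z | ∃ R : 𝓗 →L[ℂ] 𝓗,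
    (∀ x : 𝓗, ∃ h : R x ∈ H.domain, shift H z ⟨R x, h⟩ = x) ∧
    (∀ ψ : H.domain, R (shift H z ψ) = ψ)}

/-- The spectrum `σ(H) ⊆ ℂ`. -/
def spectrum (H : 𝓗 →ₗ.[ℂ] 𝓗) : Set ℂ :=
  (resolventSet H)ᶜ

/-- The real points of the spectrum; for a selfadjoint operator this is the whole spectrum. -/
def realSpectrum (H : 𝓗 →ₗ.[ℂ] 𝓗) : Set ℝ :=
  {e | (e : ℂ) ∈ spectrum H}

/-- The eigenspace `ker (H - z)`, as a subspace of `D(H)`. -/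
def eigenspace (H : 𝓗 →ₗ.[ℂ] 𝓗) (z : ℂ) : Submodule ℂ H.domain :=
  LinearMap.ker (shift H z)

/-- The real points of the point spectrum `σ_p(H)`: the real `e` for which `H - e` is not
injective. For a selfadjoint operator these are all the eigenvalues. -/
def pointSpectrum (H : 𝓗 →ₗ.[ℂ] 𝓗) : Set ℝ :=
  {e | ¬ Function.Injective (shift H (e : ℂ))}

/-- The discrete spectrum: the isolated points of the spectrum that are eigenvalues of finite
multiplicity. -/
def discreteSpectrum (H : 𝓗 →ₗ.[ℂ] 𝓗) : Set ℝ :=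
  {e | (∃ ε > 0, Set.Ioo (e - ε) (e + ε) ∩ realSpectrum H = {e}) ∧
    e ∈ pointSpectrum H ∧ FiniteDimensional ℂ (eigenspace H (e : ℂ))}

/-- The essential spectrum: the spectrum without the discrete spectrum. -/
def essentialSpectrum (H : 𝓗 →ₗ.[ℂ] 𝓗) : Set ℝ :=
  realSpectrum H \ discreteSpectrum H

/-- The expectation value `⟨ψ, Hψ⟩` (a real number when `H` is symmetric) for `ψ ∈ D(H)`. -/
def expectation (H : 𝓗 →ₗ.[ℂ] 𝓗) (ψ : H.domain) : ℝ :=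
  (inner ℂ (ψ : 𝓗) (H ψ)).re

/-- The variance `‖(H - ⟨ψ, Hψ⟩) ψ‖²` of `H` in the normalized state `ψ ∈ D(H)`. -/
def variance (H : 𝓗 →ₗ.[ℂ] 𝓗) (ψ : H.domain) : ℝ :=
  ‖H ψ - (expectation H ψ : ℂ) • (ψ : 𝓗)‖ ^ 2

/-- `H ≥ c` for some real `c`. -/
def IsBoundedBelow (H : 𝓗 →ₗ.[ℂ] 𝓗) : Prop :=
  ∃ c : ℝ, ∀ ψ : H.domain, c * ‖(ψ : 𝓗)‖ ^ 2 ≤ expectation H ψ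

/-- `E₀` is the ground state energy: an eigenvalue at the bottom of the spectrum. -/
def IsGroundStateEnergy (H : 𝓗 →ₗ.[ℂ] 𝓗) (E₀ : ℝ) : Prop :=
  E₀ ∈ pointSpectrum H ∧ IsGLB (realSpectrum H) E₀

/-- The level above the ground state energy `E₀`: the next eigenvalue or the bottom of the essential
spectrum, whichever is lower. It is `+∞` if there is neither (`H` is then `E₀` times the
identity on a finite-dimensional space). -/
def nextLevel (H : 𝓗 →ₗ.[ℂ] 𝓗) (E₀ : ℝ) : EReal :=
  min (⨅ e ∈ {e ∈ pointSpectrum H | E₀ < e}, (e : EReal)) (⨅ e ∈ essentialSpectrum H, (e : EReal))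

end QM

end

namespace QM

variable {𝓗 : Type*} [NormedAddCommGroup 𝓗] [InnerProductSpace ℂ 𝓗]

/-! Since `(E₀, μ)` contains no spectrum, `(H - E₀)(H - μ) ≥ 0` in the form sense. For a unit vector
with `e = ⟨ψ, Hψ⟩` this reads `Var ≥ (e - E₀)(μ - e)`; divide by `μ - e > 0`. The positivity
(`gap_inequality`) needs no unbounded spectral theorem: with `m` the midpoint and `r` the
half-length it says `‖(H - m)ψ‖ ≥ r‖ψ‖`, i.e. `‖(H - m)⁻¹‖ ≤ 1/r`. The resolvent is bounded and
selfadjoint, so its norm is its spectral radius. -/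

theorem shift_apply (H : 𝓗 →ₗ.[ℂ] 𝓗) (z : ℂ) (ψ : H.domain) :
    shift H z ψ = H ψ - z • (ψ : 𝓗) := rfl

/-- There is no spectrum strictly between the ground state energy and the next level. -/
theorem notMem_realSpectrum_of_lt_nextLevel (H : 𝓗 →ₗ.[ℂ] 𝓗) {E₀ e : ℝ} (h₀ : E₀ < e)
    (h₁ : (e : EReal) < nextLevel H E₀) : e ∉ realSpectrum H := by
  intro he
  -- A discrete point would be an eigenvalue above `E₀`; any other spectral point is essential.
  by_cases hd : e ∈ discreteSpectrum H
  · exact absurd (h₁.trans_le ((min_le_left _ _).trans (iInf₂_le e ⟨hd.2.1, h₀⟩))) (lt_irrefl _)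
  · exact absurd (h₁.trans_le ((min_le_right _ _).trans (iInf₂_le e ⟨he, hd⟩))) (lt_irrefl _)

/-- If `R = (H - m)⁻¹` and `m + 1 / z` is in the resolvent set of `H`, then `z` is in the resolvent
set of `R`. -/
theorem notMem_spectrum_of_resolvent {H : 𝓗 →ₗ.[ℂ] 𝓗} {m z : ℂ} {R : 𝓗 →L[ℂ] 𝓗}
    (hR₁ : ∀ x : 𝓗, ∃ h : R x ∈ H.domain, shift H m ⟨R x, h⟩ = x)
    (hR₂ : ∀ ψ : H.domain, R (shift H m ψ) = ψ) (hz : z ≠ 0)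
    (hres : m + z⁻¹ ∈ resolventSet H) : z ∉ _root_.spectrum ℂ R := by
  obtain ⟨S, hS₁, hS₂⟩ := hres
  rw [spectrum.notMem_iff, isUnit_iff_exists]
  -- From `z - R = z (H - m - z⁻¹) R`, the inverse should be `z⁻¹ (H - m) S`, and `(H - m) S = 1 +
  -- z⁻¹ S`.
  refine ⟨z⁻¹ • (1 + z⁻¹ • S), ?_, ?_⟩
  · ext x
    obtain ⟨h, hx⟩ := hS₁ x
    -- The first resolvent identity.
    have key : R x = S x - z⁻¹ • R (S x) := by
      have h2 := hR₂ ⟨S x, h⟩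
      have h3 : shift H m ⟨S x, h⟩ = x + z⁻¹ • S x := by
        rw [shift_apply] at hx ⊢
        rw [← sub_eq_zero] at hx ⊢
        rw [← hx]
        module
      rw [h3, map_add, map_smul] at h2
      rw [eq_sub_iff_add_eq, h2]
    simp only [Algebra.algebraMap_eq_smul_one, mul_apply_eq_comp,
      sub_apply, smul_apply, add_apply,
      one_apply_eq_self, map_smul, map_add, key]
    match_scalars <;> field_simp <;> ring
  · ext x
    obtain ⟨h, hx⟩ := hR₁ x
    have key : S (z • x - R x) = z • R x := by
      have h2 := hS₂ ⟨R x, h⟩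
      have h3 : z • x - R x = z • shift H (m + z⁻¹) ⟨R x, h⟩ := by
        rw [shift_apply] at hx ⊢
        rw [add_smul, ← sub_sub, hx, smul_sub, smul_inv_smul₀ hz]
      rw [h3, map_smul, h2]
    simp only [Algebra.algebraMap_eq_smul_one, mul_apply_eq_comp,
      sub_apply, smul_apply, add_apply,
      one_apply_eq_self, key]
    match_scalars <;> field_simp
    ring

theorem norm_shift_sq {H : 𝓗 →ₗ.[ℂ] 𝓗} (ψ : H.domain) (a : ℝ) :
    ‖shift H (a : ℂ) ψ‖ ^ 2 =
      ‖H ψ‖ ^ 2 - 2 * a * expectation H ψ + a ^ 2 * ‖(ψ : 𝓗)‖ ^ 2 := by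
  have h : (inner ℂ (H ψ) (ψ : 𝓗)).re = expectation H ψ := inner_re_symm (𝕜 := ℂ) _ _
  rw [shift_apply, norm_sub_sq (𝕜 := ℂ), inner_smul_right, norm_smul]
  simp only [RCLike.re_to_complex, Complex.re_ofReal_mul, h, Complex.norm_real, Real.norm_eq_abs,
    mul_pow, sq_abs]
  ring

theorem variance_eq {H : 𝓗 →ₗ.[ℂ] 𝓗} (ψ : H.domain) (hψ : ‖(ψ : 𝓗)‖ = 1) :
    variance H ψ = ‖H ψ‖ ^ 2 - expectation H ψ ^ 2 := by
  have h := norm_shift_sq ψ (expectation H ψ)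
  rw [shift_apply, hψ] at h
  rw [variance, h]
  ring

variable [CompleteSpace 𝓗]

theorem inner_apply_comm {H : 𝓗 →ₗ.[ℂ] 𝓗} (hsa : IsSelfAdjoint H) (φ ψ : H.domain) :
    inner ℂ (H φ) (ψ : 𝓗) = inner ℂ (φ : 𝓗) (H ψ) := by
  have h := LinearPMap.adjoint_isFormalAdjoint hsa.dense_domain
  rw [LinearPMap.isSelfAdjoint_def.mp hsa] at h
  exact h φ ψ

theorem inner_apply_self_eq_expectation {H : 𝓗 →ₗ.[ℂ] 𝓗} (hsa : IsSelfAdjoint H)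
    (ψ : H.domain) : inner ℂ (ψ : 𝓗) (H ψ) = (expectation H ψ : ℂ) := by
  refine (Complex.conj_eq_iff_re.mp ?_).symm
  rw [inner_conj_symm, inner_apply_comm hsa]

/-- A real interval of radius `r` around `m` free of spectrum gives `‖(H - m) ψ‖ ≥ r ‖ψ‖`. -/
theorem mul_norm_le_norm_shift {H : 𝓗 →ₗ.[ℂ] 𝓗} (hsa : IsSelfAdjoint H) {m r : ℝ} (hr : 0 < r)
    (hgap : ∀ e : ℝ, |e - m| < r → e ∉ realSpectrum H) (ψ : H.domain) :
    r * ‖(ψ : 𝓗)‖ ≤ ‖shift H (m : ℂ) ψ‖ := by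
  have hres : ∀ e : ℝ, |e - m| < r → (e : ℂ) ∈ resolventSet H := fun e he =>
    not_not.mp (hgap e he)
  obtain ⟨R, hR₁, hR₂⟩ := hres m (by simpa using hr)
  have hRsa : IsSelfAdjoint R := by
    rw [ContinuousLinearMap.isSelfAdjoint_iff_isSymmetric]
    intro x y
    obtain ⟨hx, hx'⟩ := hR₁ x
    obtain ⟨hy, hy'⟩ := hR₁ y
    have h := inner_apply_comm hsa ⟨R x, hx⟩ ⟨R y, hy⟩
    rw [shift_apply, sub_eq_iff_eq_add] at hx' hy'
    rw [hx', hy', inner_add_left, inner_add_right, inner_smul_left, inner_smul_right,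
      Complex.conj_ofReal] at h
    exact (add_right_cancel h).symm
  have hnorm : ‖R‖ ≤ r⁻¹ := by
    -- A spectral value `z` of `R` is real; if `|z| > 1/r`, then `m + 1/z` lies in the gap, a
    -- contradiction.
    have hle : spectralRadius ℂ R ≤ (r⁻¹).toNNReal := by
      refine iSup₂_le fun z hz => ?_
      by_contra! hlt
      have hzr : z = (z.re : ℂ) := hRsa.mem_spectrum_eq_re hz
      have hlt' : r⁻¹ < |z.re| := by
        have h := (Real.toNNReal_lt_iff_lt_coe (inv_pos.mpr hr).le).mp (ENNReal.coe_lt_coe.mp hlt)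
        rwa [coe_nnnorm, hzr, Complex.norm_real, Real.norm_eq_abs] at h
      have hz0 : z.re ≠ 0 := abs_pos.mp ((inv_pos.mpr hr).trans hlt')
      refine notMem_spectrum_of_resolvent hR₁ hR₂ (z := z) ?_ ?_ hz
      · rw [hzr]; exact_mod_cast hz0
      · have h := hres (m + z.re⁻¹) (by
          rw [add_sub_cancel_left, abs_inv]
          exact inv_lt_of_inv_lt₀ hr hlt')
        rw [hzr]
        exact_mod_cast h
    rw [hRsa.spectralRadius_eq_nnnorm, ENNReal.coe_le_coe] at hle
    exact (Real.le_toNNReal_iff_coe_le (inv_pos.mpr hr).le).mp hle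
  have h := R.le_of_opNorm_le hnorm (shift H m ψ)
  rwa [hR₂, inv_mul_eq_div, le_div_iff₀' hr] at h

/-- `⟨(H - a) ψ, (H - b) ψ⟩ ≥ 0` if there is no spectrum in the open interval `(a, b)`. -/
theorem gap_inequality {H : 𝓗 →ₗ.[ℂ] 𝓗} (hsa : IsSelfAdjoint H) {a b : ℝ} (hab : a < b)
    (hgap : ∀ e : ℝ, a < e → e < b → e ∉ realSpectrum H) (ψ : H.domain) :
    0 ≤ ‖H ψ‖ ^ 2 - (a + b) * expectation H ψ + a * b * ‖(ψ : 𝓗)‖ ^ 2 := by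
  have hr : 0 < (b - a) / 2 := by linarith
  have h := mul_norm_le_norm_shift hsa (m := (a + b) / 2) hr
    (fun e he => by
      rw [abs_lt] at he
      exact hgap e (by linarith) (by linarith)) ψ
  -- After squaring, the coefficient of `‖ψ‖²` is `m² - r² = a b`.
  have h2 := pow_le_pow_left₀ (by positivity) h 2
  rw [norm_shift_sq] at h2
  linear_combination h2

end QM

theorem mainTheorem4 {𝓗 : Type*} [NormedAddCommGroup 𝓗] [InnerProductSpace ℂ 𝓗] [CompleteSpace 𝓗]
    (H : 𝓗 →ₗ.[ℂ] 𝓗) (hsa : IsSelfAdjoint H) (hbdd : QM.IsBoundedBelow H)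
    (E₀ : ℝ) (hE₀ : QM.IsGroundStateEnergy H E₀)
    (hgap : (E₀ : EReal) < QM.nextLevel H E₀)
    (μ : ℝ) (hμ₀ : E₀ < μ) (hμ₁ : (μ : EReal) < QM.nextLevel H E₀)
    (ψ : H.domain) (hψ : ‖(ψ : 𝓗)‖ = 1) (hψμ : QM.expectation H ψ < μ) :
    E₀ ≥ QM.expectation H ψ - QM.variance H ψ / (μ - QM.expectation H ψ) ∧
    QM.variance H ψ = ‖H ψ‖ ^ 2 - QM.expectation H ψ ^ 2 ∧
    (∀ h : H ψ ∈ H.domain,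
      ((QM.variance H ψ : ℝ) : ℂ) =
        inner ℂ (ψ : 𝓗) (H ⟨H ψ, h⟩) - (inner ℂ (ψ : 𝓗) (H ψ)) ^ 2 ∧
      E₀ ≥ QM.expectation H ψ -
        ((inner ℂ (ψ : 𝓗) (H ⟨H ψ, h⟩)).re - QM.expectation H ψ ^ 2) /
          (μ - QM.expectation H ψ)) := by
  have hvar := QM.variance_eq ψ hψ
  have hmain : E₀ ≥ QM.expectation H ψ - QM.variance H ψ / (μ - QM.expectation H ψ) := by
    have h := QM.gap_inequality hsa hμ₀ (fun e h₀ h₁ =>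
      QM.notMem_realSpectrum_of_lt_nextLevel H h₀ ((EReal.coe_lt_coe_iff.mpr h₁).trans hμ₁)) ψ
    rw [hψ] at h
    rw [ge_iff_le, sub_le_comm, le_div_iff₀ (sub_pos.mpr hψμ), hvar]
    linear_combination h
  refine ⟨hmain, hvar, fun h => ?_⟩
  have hsq : inner ℂ (ψ : 𝓗) (H ⟨H ψ, h⟩) = ((‖H ψ‖ ^ 2 : ℝ) : ℂ) := by
    rw [← QM.inner_apply_comm hsa ψ ⟨H ψ, h⟩, inner_self_eq_norm_sq_to_K]
    norm_cast
  constructor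
  · rw [hsq, QM.inner_apply_self_eq_expectation hsa, hvar]
    push_cast
    rfl
  · rwa [hsq, Complex.ofReal_re, ← hvar]
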